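/- Let $\mathbb{K}$ be a field of characteristic $0$, with algebraic closure $\overline{\mathbb{K}}$, and let $\Delta(t,u)\in\mathbb{K}[[t]][u]$ be non-zero. Then $\Delta$ admits a factorization $$ \Delta(t,u)= c\, t^{p} \bigl(1+tS(t)\bigr) \bigl(1+tuR_1(t,u)\bigr) \bigl(u^d+tR_2(t,u)\bigr) \prod_{i=1}^k \left( \left(1-\frac{u}{\alpha_i}\right)^{d_i}+tuQ_i(t,u)\right), $$ where - $p,d,k$ are nonnegative integers and $d_1,\dots,d_k$ are positive integers, - $c\in\mathbb{K}$, and $\alpha_1,\dots,\alpha_k$ are distinct non-zero elements of $\overline{\mathbb{K}}$, - $S(t)\in\mathbb{K}[[t]]$, - $R_1(t,u)$ and $R_2(t,u)$ belong to $\mathbb{K}[[t]][u]$, with $\deg_u R_2<d$, - $Q_i(t,u)\in\overline{\mathbb{K}}[[t]][u]$, with $\deg_u Q_i<d_i$ (the zero polynomial has degree $-\infty$, and the identity holds in $\overline{\mathbb{K}}[[t]][u]$). This factorization is unique: any two of them have the same $c,p,S,R_1,d,R_2$ and $k$, and the same triples $(\alpha_i,d_i,Q_i)$ up to the order of the indices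 $i$. Moreover, consider roots in $u$, counted with multiplicity, in the field of Puiseux series $U=\sum_{n\ge n_0}a_n t^{n/m}$ ($n_0\in\mathbb{Z}$, $m\ge 1$, $a_n\in\overline{\mathbb{K}}$). Say that $U$ is infinite at $t=0$ if it contains a negative power of $t$; otherwise it is finite at $t=0$, and its value there is its constant coefficient. Then the roots of $\Delta$ that are infinite (resp. zero, finite and non-zero) at $t=0$ are exactly the roots of $1+tuR_1$ (resp. of $u^d+tR_2$, of the product over $i$); and for each $i$, the roots of $\Delta$ that equal $\alpha_i$ at $t=0$ are exactly the roots of the $i$-th factor $(1-u/\alpha_i)^{d_i}+tuQ_i$. -/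

import Mathlib

open scoped Polynomial PowerSeries HahnSeries

/-- The exponents occurring in `x` all lie in `(1/d)ℤ`. -/
def HasDenominator {L : Type*} [Field L] (d : ℕ) (x : L⟦ℚ⟧) : Prop :=
  ∀ q ∈ x.support, ∃ n : ℤ, q = (n : ℚ) / (d : ℚ)

/-- The order-preserving ring embedding of `L((t))` given by `t ↦ t^(1/d)`. -/
noncomputable def stretch (L : Type*) [Field L] (d : ℕ) (hd : 0 < d) : L⟦ℤ⟧ →+* L⟦ℚ⟧ :=
  HahnSeries.embDomainRingHom
    ((AddMonoidHom.mulRight ((d : ℚ)⁻¹)).comp (Int.castAddHom ℚ))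
    (fun a b h => by
      have hd' : (d : ℚ)⁻¹ ≠ 0 := by positivity
      simpa [hd'] using (mul_right_cancel₀ hd' (by simpa using h) : (a : ℚ) = b))
    (fun a b => by
      have hd' : (0 : ℚ) < (d : ℚ)⁻¹ := by positivity
      simp [mul_le_mul_iff_left₀ hd'])

theorem stretch_coeff {L : Type*} [Field L] (d : ℕ) (hd : 0 < d) (y : L⟦ℤ⟧) (n : ℤ) :
    (stretch L d hd y).coeff ((n : ℚ) / (d : ℚ)) = y.coeff n := by
  rw [div_eq_mul_inv]
  exact HahnSeries.embDomain_coeff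

theorem hasDenominator_stretch {L : Type*} [Field L] (d : ℕ) (hd : 0 < d) (y : L⟦ℤ⟧) :
    HasDenominator d (stretch L d hd y) := by
  intro q hq
  obtain ⟨n, -, rfl⟩ := HahnSeries.support_embDomain_subset hq
  exact ⟨n, by simp [div_eq_mul_inv]⟩

theorem HasDenominator.exists_stretch {L : Type*} [Field L] {d : ℕ} (hd : 0 < d) {x : L⟦ℚ⟧}
    (hx : HasDenominator d x) : ∃ y : L⟦ℤ⟧, stretch L d hd y = x := by
  have hd' : (0 : ℚ) < d := by exact_mod_cast hd
  have hmono : StrictMono (fun n : ℤ => (n : ℚ) / d) := fun a b h => by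
    have : (a : ℚ) < b := by exact_mod_cast h
    exact div_lt_div_of_pos_right this hd'
  have hpwo : (Function.support fun n : ℤ => x.coeff ((n : ℚ) / d)).IsPWO := by
    rw [Set.isPWO_iff_isWF, Set.isWF_iff_no_descending_seq]
    intro f hf hmem
    refine (Set.isWF_iff_no_descending_seq.1 (Set.isPWO_iff_isWF.1 x.isPWO_support))
      (fun k => (f k : ℚ) / d) (fun a b h => hmono (hf h)) ?_
    exact fun k => hmem k
  refine ⟨⟨fun n => x.coeff ((n : ℚ) / d), hpwo⟩, ?_⟩
  ext q
  by_cases hq : ∃ n : ℤ, q = (n : ℚ) / d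
  · obtain ⟨n, rfl⟩ := hq
    exact stretch_coeff d hd _ n
  · have h1 : x.coeff q = 0 := by
      by_contra h
      exact hq (hx q h)
    have h2 := mt (hasDenominator_stretch d hd ⟨fun n => x.coeff ((n : ℚ) / d), hpwo⟩ q) hq
    rw [h1]
    simpa using h2

theorem HasDenominator.mono {L : Type*} [Field L] {d e : ℕ} (he : 0 < e) {x : L⟦ℚ⟧}
    (hx : HasDenominator d x) (hd : 0 < d) : HasDenominator (d * e) x := by
  intro q hq
  obtain ⟨n, rfl⟩ := hx q hq
  refine ⟨n * e, ?_⟩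
  have h1 : (d : ℚ) ≠ 0 := by positivity
  have h2 : (e : ℚ) ≠ 0 := by positivity
  push_cast
  field_simp

theorem exists_common_stretch {L : Type*} [Field L] {x y : L⟦ℚ⟧}
    (hx : ∃ d : ℕ, 0 < d ∧ HasDenominator d x) (hy : ∃ d : ℕ, 0 < d ∧ HasDenominator d y) :
    ∃ (d : ℕ) (hd : 0 < d) (x' y' : L⟦ℤ⟧), stretch L d hd x' = x ∧ stretch L d hd y' = y := by
  obtain ⟨d, hd, hx⟩ := hx
  obtain ⟨e, he, hy⟩ := hy
  have hde : 0 < d * e := Nat.mul_pos hd he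
  obtain ⟨x', hx'⟩ := (hx.mono he hd).exists_stretch hde
  have hy2 : HasDenominator (d * e) y := by
    rw [mul_comm]
    exact hy.mono hd he
  obtain ⟨y', hy'⟩ := hy2.exists_stretch hde
  exact ⟨d * e, hde, x', y', hx', hy'⟩

/-- The field of Puiseux series (fractional Laurent series) in `t` over `L`: the series
`∑_{n ≥ n₀} a_n t^(n/d)` with `n₀ ∈ ℤ` and `d` a positive integer.  A well-ordered set of rational
exponents with a common denominator `d` is bounded below, so these are exactly the Hahn series
with exponents in `ℚ` whose exponents have a common denominator. -/
noncomputable def PuiseuxSeries (L : Type*) [Field L] : Subfield L⟦ℚ⟧ where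
  carrier := {x | ∃ d : ℕ, 0 < d ∧ HasDenominator d x}
  mul_mem' := by
    intro x y hx hy
    obtain ⟨d, hd, x', y', rfl, rfl⟩ := exists_common_stretch hx hy
    exact ⟨d, hd, by rw [← map_mul]; exact hasDenominator_stretch d hd _⟩
  one_mem' := ⟨1, one_pos, by rw [← map_one (stretch L 1 one_pos)]; exact hasDenominator_stretch _ _ _⟩
  add_mem' := by
    intro x y hx hy
    obtain ⟨d, hd, x', y', rfl, rfl⟩ := exists_common_stretch hx hy
    exact ⟨d, hd, by rw [← map_add]; exact hasDenominator_stretch d hd _⟩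
  zero_mem' := ⟨1, one_pos, by rw [← map_zero (stretch L 1 one_pos)]; exact hasDenominator_stretch _ _ _⟩
  neg_mem' := by
    intro x hx
    obtain ⟨d, hd, hx⟩ := hx
    obtain ⟨x', rfl⟩ := hx.exists_stretch hd
    exact ⟨d, hd, by rw [← map_neg]; exact hasDenominator_stretch d hd _⟩
  inv_mem' := by
    intro x hx
    obtain ⟨d, hd, hx⟩ := hx
    obtain ⟨x', rfl⟩ := hx.exists_stretch hd
    exact ⟨d, hd, by rw [← map_inv₀]; exact hasDenominator_stretch d hd _⟩

/-- The inclusion of `L[[t]]` into the field of Puiseux series over `L`. -/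
noncomputable def powerSeriesToPuiseux (L : Type*) [Field L] : L⟦X⟧ →+* PuiseuxSeries L :=
  (HahnSeries.ofPowerSeries ℚ L).codRestrict (PuiseuxSeries L) (by
    intro f
    refine ⟨1, one_pos, fun q hq => ?_⟩
    rw [HahnSeries.ofPowerSeries_apply] at hq
    obtain ⟨n, -, rfl⟩ := HahnSeries.support_embDomain_subset hq
    exact ⟨n, by simp⟩)

namespace PuiseuxSeries

variable {L : Type*} [Field L]

/-- `U` is finite at `t = 0`: no negative power of `t` occurs in `U`. -/
def IsFiniteAtZero (U : PuiseuxSeries L) : Prop :=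
  ∀ q : ℚ, q < 0 → (U : L⟦ℚ⟧).coeff q = 0

/-- `U` is infinite at `t = 0`: some negative power of `t` occurs in `U`. -/
def IsInfiniteAtZero (U : PuiseuxSeries L) : Prop :=
  ∃ q : ℚ, q < 0 ∧ (U : L⟦ℚ⟧).coeff q ≠ 0

/-- `U` is finite at `t = 0`, and equal to `a` there. -/
def IsEqualAtZero (a : L) (U : PuiseuxSeries L) : Prop :=
  IsFiniteAtZero U ∧ (U : L⟦ℚ⟧).coeff 0 = a

/-- `U` is finite and non-zero at `t = 0`. -/
def IsFiniteNonzeroAtZero (U : PuiseuxSeries L) : Prop :=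
  IsFiniteAtZero U ∧ (U : L⟦ℚ⟧).coeff 0 ≠ 0

end PuiseuxSeries

/-- The roots of `P ∈ L[[t]][u]` among the Puiseux series over `L`, with multiplicities. -/
noncomputable def puiseuxRoots {L : Type*} [Field L] (P : L⟦X⟧[X]) :
    Multiset (PuiseuxSeries L) :=
  (P.map (powerSeriesToPuiseux L)).roots

open Classical in
/-- The Puiseux roots of `P`, with multiplicities, that have the property `p`. -/
noncomputable def puiseuxRootsWith {L : Type*} [Field L] (p : PuiseuxSeries L → Prop)
    (P : L⟦X⟧[X]) : Multiset (PuiseuxSeries L) :=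
  (puiseuxRoots P).filter p

/-- Extension of scalars `K[[t]][u] → L[[t]][u]`. -/
noncomputable def extendScalars {K : Type*} (L : Type*) [Field K] [Field L] [Algebra K L] :
    K⟦X⟧[X] →+* L⟦X⟧[X] :=
  Polynomial.mapRingHom (PowerSeries.map (algebraMap K L))

/-- The series `t`, as an element of `F[[t]][u]`. -/
noncomputable def tVar (F : Type*) [Field F] : F⟦X⟧[X] := Polynomial.C PowerSeries.X

/-- The variable `u` of `F[[t]][u]`. -/
noncomputable def uVar (F : Type*) [Field F] : F⟦X⟧[X] := Polynomial.X

/-- The constant `a ∈ F`, as an element of `F[[t]][u]`. -/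
noncomputable def constant {F : Type*} [Field F] (a : F) : F⟦X⟧[X] :=
  Polynomial.C (PowerSeries.C a)

/-- The parameters `c, p, S, R₁, d, R₂, k, (αᵢ), (dᵢ), (Qᵢ)` of a canonical factorization;
`dᵢ` is called `e i`. -/
structure FactorizationData (K L : Type*) [Field K] [Field L] where
  c : K
  p : ℕ
  S : K⟦X⟧
  R₁ : K⟦X⟧[X]
  d : ℕ
  R₂ : K⟦X⟧[X]
  k : ℕ
  α : Fin k → L
  e : Fin k → ℕ
  Q : Fin k → L⟦X⟧[X]

namespace FactorizationData

variable {K L : Type*} [Field K] [Field L]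

/-- `c t^p (1 + t S(t))` -/
noncomputable def unitPart (D : FactorizationData K L) : K⟦X⟧[X] :=
  constant D.c * tVar K ^ D.p * (1 + tVar K * Polynomial.C D.S)

/-- `1 + t u R₁(t,u)` -/
noncomputable def infiniteFactor (D : FactorizationData K L) : K⟦X⟧[X] :=
  1 + tVar K * uVar K * D.R₁

/-- `u^d + t R₂(t,u)` -/
noncomputable def zeroFactor (D : FactorizationData K L) : K⟦X⟧[X] :=
  uVar K ^ D.d + tVar K * D.R₂

/-- `(1 - u/αᵢ)^{dᵢ} + t u Qᵢ(t,u)` -/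
noncomputable def finiteFactor (D : FactorizationData K L) (i : Fin D.k) : L⟦X⟧[X] :=
  (1 - constant (D.α i)⁻¹ * uVar L) ^ D.e i + tVar L * uVar L * D.Q i

/-- `D` is a canonical factorization of `Δ`.  The equality is read in `L[[t]][u]`, where the
`Qᵢ` live.  Degrees are such that the zero polynomial has degree `⊥`, below every integer. -/
structure IsFactorizationOf [Algebra K L] (D : FactorizationData K L) (Δ : K⟦X⟧[X]) : Prop where
  degree_R₂ : D.R₂.degree < D.d
  α_ne_zero : ∀ i, D.α i ≠ 0
  α_injective : Function.Injective D.α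
  e_pos : ∀ i, 0 < D.e i
  degree_Q : ∀ i, (D.Q i).degree < D.e i
  eq : extendScalars L Δ =
    extendScalars L D.unitPart * extendScalars L D.infiniteFactor *
      extendScalars L D.zeroFactor * ∏ i, D.finiteFactor i

/-- Two sets of parameters agree, up to a renumbering of the triples `(αᵢ, dᵢ, Qᵢ)`. -/
def Equivalent (D D' : FactorizationData K L) : Prop :=
  D.c = D'.c ∧ D.p = D'.p ∧ D.S = D'.S ∧ D.R₁ = D'.R₁ ∧ D.d = D'.d ∧ D.R₂ = D'.R₂ ∧
    ∃ σ : Fin D.k ≃ Fin D'.k, ∀ i,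
      D.α i = D'.α (σ i) ∧ D.e i = D'.e (σ i) ∧ D.Q i = D'.Q (σ i)

end FactorizationData

/-!
Divide `Δ` by the largest possible power of `t` and reduce modulo `t`: what remains is
`δ(u) ∈ K[u]`, which over `L` is `const · u^d · ∏ (1 - u/αᵢ)^{dᵢ}`.  Since `K[[t]]` is `t`-adically
complete, Hensel's lemma lifts a factorization of `δ` into pairwise coprime polynomials, all monic
but the constant one, to a factorization of `Δ / t^p`; the drop of degree modulo `t` is absorbed by
the lift of the constant, which becomes a unit times `1 + t u R₁`.

For uniqueness, `δ` determines the `αᵢ` and the exponents.  Since the factors with a finite root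
have a unit as leading coefficient, coprimality modulo `t` lifts to coprimality (look at the
resultant).  Hence two lifts of the same factor of `δ` divide one another, and differ by a unit of
`L[[t]]`, which the normalization of the leading or of the constant coefficient forces to be `1`.

A root that is finite at `t = 0` reduces to a root of the reduced polynomial, so `1 + t u R₁` has
none.  The roots of the factors with a unit as leading coefficient are integral over `L[[t]]`, that
is, finite at `t = 0`.
-/

section Hensel

open Polynomial

variable {A : Type*} [CommRing A]

theorem map_eq_zero_iff_mem_map_C_ker {B : Type*} [CommRing B] (φ : A →+* B) {P : A[X]} :
    P.map φ = 0 ↔ P ∈ (RingHom.ker φ).map C := by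
  rw [← ker_mapRingHom, RingHom.mem_ker, coe_mapRingHom]

theorem mem_map_C_iff_map_mk_eq_zero {I : Ideal A} {P : A[X]} :
    P ∈ I.map C ↔ P.map (Ideal.Quotient.mk I) = 0 := by
  rw [map_eq_zero_iff_mem_map_C_ker, Ideal.mk_ker]

theorem modByMonic_mem_map_C {I : Ideal A} {P G : A[X]} (hG : G.Monic) (hP : P ∈ I.map C) :
    P %ₘ G ∈ I.map C := by
  rw [mem_map_C_iff_map_mk_eq_zero] at hP ⊢
  rw [map_modByMonic _ hG, hP, zero_modByMonic]

theorem divByMonic_mem_map_C {I : Ideal A} {P G : A[X]} (hG : G.Monic) (hP : P ∈ I.map C) :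
    P /ₘ G ∈ I.map C := by
  rw [mem_map_C_iff_map_mk_eq_zero] at hP ⊢
  rw [map_divByMonic _ hG, hP, zero_divByMonic]

/-- One Newton step: with `E = P - G H`, correct `G` by `V E mod G`, which keeps `G` monic. -/
theorem exists_monic_hensel_step {I J : Ideal A} (hJ : J ≤ I) {P G H U V : A[X]} (hG : G.Monic)
    (hP : P - G * H ∈ J.map C) (hUV : U * G + V * H - 1 ∈ I.map C) :
    ∃ G' H' : A[X], G'.Monic ∧ G'.natDegree = G.natDegree ∧ G' - G ∈ J.map C ∧
      P - G' * H' ∈ (J * I).map C ∧ U * G' + V * H' - 1 ∈ I.map C := by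
  set E := P - G * H with hE
  set q := V * E /ₘ G
  set r := V * E %ₘ G
  have hdiv : r + G * q = V * E := modByMonic_add_div (V * E) G
  have hVE : V * E ∈ J.map C := Ideal.mul_mem_left _ V hP
  have hr : r ∈ J.map C := modByMonic_mem_map_C hG hVE
  have hs : E * U + q * H ∈ J.map C :=
    add_mem (Ideal.mul_mem_right _ _ hP)
      (Ideal.mul_mem_right _ _ (divByMonic_mem_map_C hG hVE))
  have hJI : J.map C ≤ I.map (C : A →+* A[X]) := Ideal.map_mono hJ
  obtain ⟨hmonic, hdeg⟩ : (G + r).Monic ∧ (G + r).natDegree = G.natDegree := by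
    nontriviality A
    have hlt : r.degree < G.degree := degree_modByMonic_lt _ hG
    exact ⟨hG.add_of_left hlt, natDegree_add_eq_left_of_degree_lt hlt⟩
  refine ⟨G + r, H + (E * U + q * H), hmonic, hdeg, by simpa using hr, ?_, ?_⟩
  · have herr : P - (G + r) * (H + (E * U + q * H)) =
        -(E * (U * G + V * H - 1)) - r * (E * U + q * H) := by
      linear_combination (-H) * hdiv - hE
    rw [herr, Ideal.map_mul]
    exact sub_mem (neg_mem (Ideal.mul_mem_mul hP hUV)) (Ideal.mul_mem_mul hr (hJI hs))
  · have hcop : U * (G + r) + V * (H + (E * U + q * H)) - 1 =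
        (U * G + V * H - 1) + (U * r + V * (E * U + q * H)) := by ring
    rw [hcop]
    exact add_mem hUV (hJI (add_mem (Ideal.mul_mem_left _ _ hr) (Ideal.mul_mem_left _ _ hs)))

theorem exists_monic_hensel_seq {I : Ideal A} {P G H U V : A[X]} (hG : G.Monic)
    (hP : P - G * H ∈ I.map C) (hUV : U * G + V * H - 1 ∈ I.map C) :
    ∃ s : ℕ → A[X], s 0 = G ∧ ∀ n, (s n).Monic ∧ (s n).natDegree = G.natDegree ∧
      s (n + 1) - s n ∈ (I ^ (n + 1)).map C ∧ ∃ H', P - s n * H' ∈ (I ^ (n + 1)).map C := by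
  let Approx (n : ℕ) (g : A[X] × A[X]) : Prop := g.1.Monic ∧ g.1.natDegree = G.natDegree ∧
    P - g.1 * g.2 ∈ (I ^ (n + 1)).map C ∧ U * g.1 + V * g.2 - 1 ∈ I.map C
  have hstep (n : ℕ) (g : {g // Approx n g}) :
      ∃ g' : {g // Approx (n + 1) g}, g'.1.1 - g.1.1 ∈ (I ^ (n + 1)).map C := by
    obtain ⟨g, hmonic, hdeg, hmul, hcop⟩ := g
    obtain ⟨G', H', hmonic', hdeg', hsub, hmul', hcop'⟩ :=
      exists_monic_hensel_step (Ideal.pow_le_self n.succ_ne_zero) hmonic hmul hcop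
    exact ⟨⟨(G', H'), hmonic', hdeg'.trans hdeg, hmul', hcop'⟩, hsub⟩
  choose step hmem using hstep
  let s (n : ℕ) : {g // Approx n g} :=
    n.rec ⟨(G, H), hG, rfl, by simpa using hP, hUV⟩ step
  exact ⟨fun n => (s n).1.1, rfl,
    fun n => ⟨(s n).2.1, (s n).2.2.1, hmem n (s n), _, (s n).2.2.2.1⟩⟩

theorem eq_zero_of_forall_mem_pow {I : Ideal A} [IsHausdorff I A] {a : A} (ha : ∀ n, a ∈ I ^ n) :
    a = 0 :=
  IsHausdorff.haus ‹_› a fun n => by simpa [SModEq.zero] using ha n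

theorem exists_polynomial_adic_limit {I : Ideal A} [IsPrecomplete I A] {N : ℕ} {s : ℕ → A[X]}
    (hdeg : ∀ n, (s n).natDegree ≤ N) (hs : ∀ n, s (n + 1) - s n ∈ (I ^ n).map C) :
    ∃ G : A[X], G.natDegree ≤ N ∧ ∀ n, G - s n ∈ (I ^ n).map C := by
  have hlim (k : ℕ) : ∃ a : A, ∀ n, (s n).coeff k ≡ a [SMOD (I ^ n • ⊤ : Submodule A A)] := by
    refine IsPrecomplete.prec ‹_› fun {m n} hmn => ?_
    simp only [smul_eq_mul, Ideal.mul_top]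
    induction n, hmn using Nat.le_induction with
    | base => rfl
    | succ n hmn ih =>
      refine ih.trans (SModEq.sub_mem.2 ?_)
      rw [← neg_sub, ← coeff_sub]
      exact neg_mem (Ideal.pow_le_pow_right hmn (Ideal.mem_map_C_iff.1 (hs n) k))
  choose a ha using hlim
  have hcoeff (k n : ℕ) : a k - (s n).coeff k ∈ I ^ n := by
    simpa [SModEq.sub_mem] using (ha k n).symm
  let G : A[X] := ∑ k ∈ Finset.range (N + 1), monomial k (a k)
  have hG (k : ℕ) : G.coeff k = if k ≤ N then a k else 0 := by
    simp [G, finsetSum_coeff, coeff_monomial]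
  refine ⟨G, natDegree_le_iff_coeff_eq_zero.2 fun k hk => by rw [hG, if_neg hk.not_ge], ?_⟩
  refine fun n => Ideal.mem_map_C_iff.2 fun k => ?_
  rw [coeff_sub, hG]
  split_ifs with hk
  · exact hcoeff k n
  · simp [coeff_eq_zero_of_natDegree_lt ((hdeg n).trans_lt (not_le.1 hk))]

theorem exists_monic_adic_limit {I : Ideal A} [IsAdicComplete I A] {N : ℕ} {s : ℕ → A[X]}
    (hmonic : ∀ n, (s n).Monic) (hdeg : ∀ n, (s n).natDegree = N)
    (hs : ∀ n, s (n + 1) - s n ∈ (I ^ n).map C) :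
    ∃ G : A[X], G.Monic ∧ ∀ n, G - s n ∈ (I ^ n).map C := by
  obtain ⟨G, hG, hlim⟩ := exists_polynomial_adic_limit (fun n => (hdeg n).le) hs
  refine ⟨G, monic_of_natDegree_le_of_coeff_eq_one N hG (sub_eq_zero.1 ?_), hlim⟩
  refine eq_zero_of_forall_mem_pow (I := I) fun n => ?_
  have hlead : (s n).coeff N = 1 := hdeg n ▸ (hmonic n).coeff_natDegree
  simpa [hlead] using Ideal.mem_map_C_iff.1 (hlim n) N

theorem dvd_of_forall_exists_sub_mem_pow {I : Ideal A} [IsHausdorff I A] {P G : A[X]}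
    (hG : G.Monic) (h : ∀ n, ∃ H, P - G * H ∈ (I ^ n).map C) : G ∣ P := by
  rw [← modByMonic_eq_zero_iff_dvd hG]
  ext k
  refine eq_zero_of_forall_mem_pow (I := I) fun n => ?_
  obtain ⟨H, hH⟩ := h n
  have hmod : (P - G * H) %ₘ G = P %ₘ G := by
    rw [sub_modByMonic, (modByMonic_eq_zero_iff_dvd hG).2 (dvd_mul_right G H), sub_zero]
  exact Ideal.mem_map_C_iff.1 (hmod ▸ modByMonic_mem_map_C hG hH) k

theorem exists_monic_dvd_of_approx {I : Ideal A} [IsAdicComplete I A] {P G H U V : A[X]}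
    (hG : G.Monic) (hP : P - G * H ∈ I.map C) (hUV : U * G + V * H - 1 ∈ I.map C) :
    ∃ G' : A[X], G'.Monic ∧ G' - G ∈ I.map C ∧ G' ∣ P := by
  obtain ⟨s, hs0, hs⟩ := exists_monic_hensel_seq hG hP hUV
  obtain ⟨G', hG', hlim⟩ := exists_monic_adic_limit (fun n => (hs n).1) (fun n => (hs n).2.1)
    fun n => Ideal.map_mono (Ideal.pow_le_pow_right n.le_succ) (hs n).2.2.1
  refine ⟨G', hG', ?_, dvd_of_forall_exists_sub_mem_pow (I := I) hG' fun n => ?_⟩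
  · rw [← sub_add_sub_cancel G' (s 1), ← hs0]
    exact add_mem (by simpa using hlim 1) (by simpa using (hs 0).2.2.1)
  · obtain ⟨H', hH'⟩ := (hs n).2.2.2
    have hdiff : P - G' * H' = (P - s n * H') - (G' - s n) * H' := by ring
    exact ⟨H', hdiff ▸ sub_mem (Ideal.map_mono (Ideal.pow_le_pow_right n.le_succ) hH')
      (Ideal.mul_mem_right _ _ (hlim n))⟩

variable {B : Type*} [CommRing B] {φ : A →+* B}

theorem exists_monic_lift_mul [IsAdicComplete (RingHom.ker φ) A] (hφ : Function.Surjective φ)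
    {P : A[X]} {g h : B[X]} (hg : g.Monic) (hgh : IsCoprime g h) (hP : P.map φ = g * h) :
    ∃ G H : A[X], P = G * H ∧ G.Monic ∧ G.map φ = g ∧ H.map φ = h := by
  obtain ⟨u, v, huv⟩ := hgh
  obtain ⟨G, rfl, -, hG⟩ :=
    lifts_and_natDegree_eq_and_monic ((mem_lifts g).2 (map_surjective φ hφ g)) hg
  obtain ⟨H, rfl⟩ := map_surjective φ hφ h
  obtain ⟨U, rfl⟩ := map_surjective φ hφ u
  obtain ⟨V, rfl⟩ := map_surjective φ hφ v
  have hPGH : P - G * H ∈ (RingHom.ker φ).map C := by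
    simp [← map_eq_zero_iff_mem_map_C_ker, hP]
  have hUV : U * G + V * H - 1 ∈ (RingHom.ker φ).map C := by
    simp [← map_eq_zero_iff_mem_map_C_ker, huv]
  obtain ⟨G', hG', hsub, H', rfl⟩ := exists_monic_dvd_of_approx hG hPGH hUV
  have hGG' : G'.map φ = G.map φ := by
    rwa [← map_eq_zero_iff_mem_map_C_ker, Polynomial.map_sub, sub_eq_zero] at hsub
  rw [Polynomial.map_mul, hGG'] at hP
  exact ⟨G', H', rfl, hG', hGG', hg.isRegular.left hP⟩

theorem exists_monic_lift_prod [Nontrivial B] [IsAdicComplete (RingHom.ker φ) A]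
    (hφ : Function.Surjective φ) {ι : Type*} (s : Finset ι) {g : ι → B[X]}
    (hg : ∀ i ∈ s, (g i).Monic) (hcop : (s : Set ι).Pairwise (Function.onFun IsCoprime g))
    {P : A[X]} (hP : P.Monic) (hPg : P.map φ = ∏ i ∈ s, g i) :
    ∃ G : ι → A[X], P = ∏ i ∈ s, G i ∧ ∀ i ∈ s, (G i).Monic ∧ (G i).map φ = g i := by
  classical
  induction s using Finset.induction_on generalizing P with
  | empty =>
    refine ⟨0, eq_one_of_monic_natDegree_zero hP ?_, by simp⟩
    rw [← hP.natDegree_map φ, hPg, Finset.prod_empty, natDegree_one]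
  | insert a s ha ih =>
    rw [Finset.prod_insert ha] at hPg
    have hcopa : ∀ i ∈ s, IsCoprime (g a) (g i) := fun i hi =>
      hcop (by simp) (by simp [hi]) (ne_of_mem_of_not_mem hi ha).symm
    obtain ⟨G, H, rfl, hG, hGg, hH⟩ := exists_monic_lift_mul hφ
      (hg a (Finset.mem_insert_self a s)) (IsCoprime.prod_right hcopa) hPg
    obtain ⟨F, rfl, hF⟩ := ih (fun i hi => hg i (Finset.mem_insert_of_mem hi))
      (hcop.mono (by simp)) (hG.of_mul_monic_left hP) hH
    have hupd (i : ι) (hi : i ∈ s) : Function.update F a G i = F i :=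
      Function.update_of_ne (ne_of_mem_of_not_mem hi ha) _ _
    refine ⟨Function.update F a G, ?_, (Finset.forall_mem_insert ..).2 ⟨by simp [hG, hGg], ?_⟩⟩
    · rw [Finset.prod_insert ha, Function.update_self, Finset.prod_congr rfl hupd]
    · exact fun i hi => by simpa only [hupd i hi] using hF i hi

theorem isCoprime_of_isCoprime_map_of_monic [Nontrivial B] [IsLocalHom φ] {G H : A[X]}
    (hG : G.Monic) (h : IsCoprime (G.map φ) (H.map φ)) : IsCoprime G H := by
  rw [← isUnit_resultant_iff_isCoprime hG]
  rw [← isUnit_resultant_iff_isCoprime (hG.map φ), hG.natDegree_map φ] at h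
  refine isUnit_of_map_unit φ _ ?_
  obtain ⟨k, hk⟩ := Nat.exists_eq_add_of_le (natDegree_map_le (f := φ) (p := H))
  have hlead : (G.map φ).coeff G.natDegree = 1 := by rw [coeff_map, hG.coeff_natDegree, map_one]
  rwa [← resultant_map_map, hk, resultant_add_right_deg _ _ _ _ _ le_rfl, hlead, one_pow, one_mul]

theorem isCoprime_of_isCoprime_map [Nontrivial B] [IsLocalHom φ] {G H : A[X]}
    (hG : IsUnit G.leadingCoeff) (h : IsCoprime (G.map φ) (H.map φ)) : IsCoprime G H := by
  obtain ⟨c, hc⟩ := hG.exists_left_inv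
  have hcunit : IsUnit (C c) := isUnit_C.2 (.of_mul_eq_one _ hc)
  rw [← isCoprime_mul_unit_left_left (hcunit.map (mapRingHom φ)), coe_mapRingHom,
    ← Polynomial.map_mul] at h
  exact (isCoprime_mul_unit_left_left hcunit G H).1
    (isCoprime_of_isCoprime_map_of_monic (monic_C_mul_of_mul_leadingCoeff_eq_one hc) h)

theorem exists_eq_mul_C_of_mul_eq_mul [Nontrivial B] [IsLocalHom φ] {f g F G : A[X]}
    (hF : IsUnit F.leadingCoeff) (hdeg : f.natDegree ≤ F.natDegree)
    (hcop : IsCoprime (F.map φ) (g.map φ)) (h : f * g = F * G) : ∃ a : A, f = F * C a := by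
  have hdvd : F ∣ f := (isCoprime_of_isCoprime_map hF hcop).dvd_of_dvd_mul_right ⟨G, h⟩
  obtain ⟨q, rfl⟩ := hdvd
  obtain rfl | hq := eq_or_ne q 0
  · exact ⟨0, by simp⟩
  rw [natDegree_mul' (by simpa [hF.mul_right_eq_zero] using hq)] at hdeg
  exact ⟨q.coeff 0, by rw [← eq_C_of_natDegree_eq_zero (by lia)]⟩

end Hensel

section Reduction

open Polynomial

/-- Reduction modulo `t`, as a ring homomorphism `F[[t]][u] → F[u]`. -/
noncomputable def reduction (F : Type*) [Field F] : F⟦X⟧[X] →+* F[X] :=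
  mapRingHom PowerSeries.constantCoeff

variable {F : Type*} [Field F]

theorem reduction_apply (P : F⟦X⟧[X]) : reduction F P = P.map PowerSeries.constantCoeff := rfl

theorem coeff_reduction (P : F⟦X⟧[X]) (n : ℕ) :
    (reduction F P).coeff n = PowerSeries.constantCoeff (P.coeff n) :=
  coeff_map _ n

@[simp]
theorem reduction_C (f : F⟦X⟧) : reduction F (C f) = C (PowerSeries.constantCoeff f) :=
  map_C _

@[simp]
theorem reduction_tVar : reduction F (tVar F) = 0 := by simp [tVar]

@[simp]
theorem reduction_uVar : reduction F (uVar F) = X := map_X _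

@[simp]
theorem reduction_constant (a : F) : reduction F (constant a) = C a := by simp [constant]

theorem reduction_extendScalars {K : Type*} [Field K] [Algebra K F] (P : K⟦X⟧[X]) :
    reduction F (extendScalars F P) = (reduction K P).map (algebraMap K F) := by
  ext n
  simp only [coeff_reduction, extendScalars, coe_mapRingHom, coeff_map,
    ← PowerSeries.coeff_zero_eq_constantCoeff_apply, PowerSeries.coeff_map]

theorem extendScalars_C {K : Type*} [Field K] [Algebra K F] (f : K⟦X⟧) :
    extendScalars F (C f) = C (PowerSeries.map (algebraMap K F) f) := map_C _

theorem coeff_zero_extendScalars {K : Type*} [Field K] [Algebra K F] (P : K⟦X⟧[X]) :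
    (extendScalars F P).coeff 0 = PowerSeries.map (algebraMap K F) (P.coeff 0) := coeff_map _ _

theorem extendScalars_injective {K : Type*} [Field K] [Algebra K F] :
    Function.Injective (extendScalars (K := K) F) :=
  map_injective _ (PowerSeries.map_injective _ (algebraMap K F).injective)

instance : IsLocalHom (PowerSeries.constantCoeff (R := F)) :=
  ⟨fun _ => PowerSeries.isUnit_iff_constantCoeff.2⟩

instance : IsAdicComplete (RingHom.ker (PowerSeries.constantCoeff (R := F))) F⟦X⟧ := by
  rw [PowerSeries.ker_coeff_eq_max_ideal, PowerSeries.maximalIdeal_eq_span_X]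
  infer_instance

theorem isUnit_leadingCoeff_of_natDegree_le {P : F⟦X⟧[X]} (hP : reduction F P ≠ 0)
    (hdeg : P.natDegree ≤ (reduction F P).natDegree) : IsUnit P.leadingCoeff := by
  have hdeg' : P.natDegree = (reduction F P).natDegree := hdeg.antisymm natDegree_map_le
  rw [PowerSeries.isUnit_iff_constantCoeff, leadingCoeff, ← coeff_reduction, hdeg',
    coeff_natDegree]
  exact (leadingCoeff_ne_zero.2 hP).isUnit

theorem tVar_ne_zero : tVar F ≠ 0 := C_ne_zero.2 PowerSeries.X_ne_zero

theorem prime_tVar : Prime (tVar F) := prime_C_iff.2 PowerSeries.X_prime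

theorem tVar_dvd_iff {P : F⟦X⟧[X]} : tVar F ∣ P ↔ reduction F P = 0 := by
  simp [tVar, C_dvd_iff_dvd_coeff, Polynomial.ext_iff, coeff_reduction, PowerSeries.X_dvd_iff]

theorem exists_eq_tVar_pow_mul {P : F⟦X⟧[X]} (hP : P ≠ 0) :
    ∃ (n : ℕ) (Q : F⟦X⟧[X]), P = tVar F ^ n * Q ∧ reduction F Q ≠ 0 := by
  obtain ⟨Q, hPQ, hQ⟩ :=
    (FiniteMultiplicity.of_prime_left prime_tVar hP).exists_eq_pow_mul_and_not_dvd
  exact ⟨_, Q, hPQ, mt tVar_dvd_iff.2 hQ⟩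

theorem multiplicity_tVar_pow_mul (n : ℕ) {P : F⟦X⟧[X]} (hP : reduction F P ≠ 0) :
    multiplicity (tVar F) (tVar F ^ n * P) = n := by
  refine multiplicity_eq_of_dvd_of_not_dvd (dvd_mul_right _ _) ?_
  rwa [pow_succ, mul_dvd_mul_iff_left (pow_ne_zero n tVar_ne_zero), tVar_dvd_iff]

theorem degree_tVar_mul (P : F⟦X⟧[X]) : (tVar F * P).degree = P.degree :=
  degree_C_mul PowerSeries.X_ne_zero

theorem degree_tVar_mul_uVar_mul_le_iff {P : F⟦X⟧[X]} {n : ℕ} :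
    (tVar F * uVar F * P).degree ≤ n ↔ P.degree < n := by
  rw [mul_assoc, degree_tVar_mul, uVar, mul_comm, degree_mul_X]
  obtain rfl | hP := eq_or_ne P 0
  · simp
  · rw [degree_eq_natDegree hP]
    exact_mod_cast Nat.succ_le_iff

theorem exists_eq_add_tVar_mul {P Q : F⟦X⟧[X]} (h : reduction F P = reduction F Q) :
    ∃ R, P = Q + tVar F * R := by
  obtain ⟨R, hR⟩ : tVar F ∣ P - Q := by rw [tVar_dvd_iff, map_sub, h, sub_self]
  exact ⟨R, by rw [← hR, add_sub_cancel]⟩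

theorem exists_eq_add_tVar_mul_uVar_mul {P Q : F⟦X⟧[X]} (h : reduction F P = reduction F Q)
    (h0 : P.coeff 0 = Q.coeff 0) : ∃ R, P = Q + tVar F * uVar F * R := by
  obtain ⟨R, rfl⟩ := exists_eq_add_tVar_mul h
  obtain ⟨R, rfl⟩ : uVar F ∣ R := by
    rw [uVar, X_dvd_iff]
    simpa [tVar, PowerSeries.X_ne_zero] using h0
  exact ⟨R, by rw [mul_assoc]⟩

theorem exists_eq_C_mul_of_reduction_eq {P : F⟦X⟧[X]} {b : F} {g : F[X]} (hb : b ≠ 0)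
    (hg : g.coeff 0 = 1) (h : reduction F P = C b * g) :
    ∃ Q, P = C (P.coeff 0) * Q ∧ reduction F Q = g ∧ Q.coeff 0 = 1 ∧ Q.degree = P.degree := by
  have hP0 : PowerSeries.constantCoeff (P.coeff 0) = b := by
    rw [← coeff_reduction, h, coeff_C_mul, hg, mul_one]
  have hinv : P.coeff 0 * (P.coeff 0)⁻¹ = 1 := PowerSeries.mul_inv_cancel _ (by rwa [hP0])
  refine ⟨C (P.coeff 0)⁻¹ * P, ?_, ?_, ?_, ?_⟩
  · rw [← mul_assoc, ← C_mul, hinv, C_1, one_mul]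
  · rw [map_mul, reduction_C, h, ← mul_assoc, ← C_mul, PowerSeries.constantCoeff_inv, hP0,
      inv_mul_cancel₀ hb, C_1, one_mul]
  · rw [coeff_C_mul, mul_comm, hinv]
  · exact degree_C_mul (right_ne_zero_of_mul_eq_one hinv)

end Reduction

section LinearFactor

open Polynomial

variable {F : Type*} [Field F] {a : F}

theorem one_sub_C_inv_mul_X_eq (ha : a ≠ 0) :
    (1 - C a⁻¹ * X : F[X]) = C (-a⁻¹) * (X - C a) := by
  rw [mul_sub, ← C_mul, neg_mul, inv_mul_cancel₀ ha, C_neg, C_neg, C_1]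
  ring

theorem X_sub_C_pow_eq (ha : a ≠ 0) (n : ℕ) :
    (X - C a) ^ n = C ((-a) ^ n) * (1 - C a⁻¹ * X) ^ n := by
  rw [C_pow, ← mul_pow, one_sub_C_inv_mul_X_eq ha, ← mul_assoc, ← C_mul, neg_mul_neg,
    mul_inv_cancel₀ ha, C_1, one_mul]

theorem associated_one_sub_C_inv_mul_X_pow (ha : a ≠ 0) (n : ℕ) :
    Associated ((1 - C a⁻¹ * X) ^ n) ((X - C a) ^ n) := by
  rw [X_sub_C_pow_eq ha]
  exact associated_unit_mul_right _ _ (isUnit_C.2 (pow_ne_zero n (neg_ne_zero.2 ha)).isUnit)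

theorem coeff_zero_one_sub_C_inv_mul_X_pow (a : F) (n : ℕ) :
    ((1 - C a⁻¹ * X : F[X]) ^ n).coeff 0 = 1 := by
  simp [coeff_zero_eq_eval_zero]

end LinearFactor

section UnitPart

namespace FactorizationData

variable {K L : Type*} [Field K] [Field L]

/-- The series `c (1 + t S(t))`, i.e. the unit part of a factorization without its power of `t`. -/
noncomputable def unitSeries (D : FactorizationData K L) : K⟦X⟧ :=
  PowerSeries.C D.c * (1 + PowerSeries.X * D.S)

theorem unitPart_eq (D : FactorizationData K L) :
    D.unitPart = tVar K ^ D.p * Polynomial.C D.unitSeries := by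
  simp only [unitPart, constant, tVar, unitSeries, map_mul, map_add, map_one]
  ring

theorem constantCoeff_unitSeries (D : FactorizationData K L) :
    PowerSeries.constantCoeff D.unitSeries = D.c := by simp [unitSeries]

end FactorizationData

end UnitPart

section Existence

open Polynomial

variable {F : Type*} [Field F]

theorem exists_eq_C_mul_one_add_X_mul {f : F⟦X⟧} (hf : PowerSeries.constantCoeff f ≠ 0) :
    ∃ S, f = PowerSeries.C (PowerSeries.constantCoeff f) * (1 + PowerSeries.X * S) := by
  set c := PowerSeries.constantCoeff f
  obtain ⟨S, hS⟩ : PowerSeries.X ∣ PowerSeries.C c⁻¹ * f - 1 := by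
    rw [PowerSeries.X_dvd_iff, map_sub, map_mul, PowerSeries.constantCoeff_C, map_one,
      inv_mul_cancel₀ hf, sub_self]
  refine ⟨S, ?_⟩
  rw [← hS, add_sub_cancel, ← mul_assoc, ← map_mul, mul_inv_cancel₀ hf, map_one, one_mul]

theorem exists_eq_uVar_pow_add_of_monic {Z : F⟦X⟧[X]} {d : ℕ} (hZ : Z.Monic)
    (h : reduction F Z = X ^ d) : ∃ R : F⟦X⟧[X], R.degree < d ∧ Z = uVar F ^ d + tVar F * R := by
  obtain ⟨R, hR⟩ := exists_eq_add_tVar_mul (P := Z) (Q := uVar F ^ d) (by simp [h])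
  have hdeg : Z.degree = d := by
    rw [← hZ.degree_map PowerSeries.constantCoeff, ← reduction_apply, h, degree_X_pow]
  refine ⟨R, ?_, hR⟩
  rw [← degree_tVar_mul, ← add_sub_cancel_left (uVar F ^ d) (tVar F * R), ← hR, ← hdeg]
  exact degree_sub_lt_left (by rw [hdeg, uVar, degree_X_pow]) hZ.ne_zero
    (by rw [hZ.leadingCoeff, uVar, leadingCoeff_X_pow])

theorem exists_eq_zeroFactor_mul {P : F⟦X⟧[X]} (hP : reduction F P ≠ 0) :
    ∃ (d : ℕ) (R H : F⟦X⟧[X]), R.degree < d ∧ P = (uVar F ^ d + tVar F * R) * H ∧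
      (reduction F H).coeff 0 ≠ 0 := by
  obtain ⟨d, δ, hδ, hXδ⟩ : ∃ d δ, reduction F P = X ^ d * δ ∧ ¬ X ∣ δ :=
    ⟨_, by simpa using exists_eq_pow_rootMultiplicity_mul_and_not_dvd _ hP 0⟩
  obtain ⟨Z, H, rfl, hZ, hZd, hH⟩ := exists_monic_lift_mul PowerSeries.constantCoeff_surj
    (monic_X_pow _) (irreducible_X.coprime_iff_not_dvd.2 hXδ).pow_left hδ
  obtain ⟨R, hR, rfl⟩ := exists_eq_uVar_pow_add_of_monic hZ hZd
  exact ⟨d, R, H, hR, rfl, by rwa [reduction_apply, hH, ne_eq, ← X_dvd_iff]⟩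

theorem exists_eq_monic_mul_infiniteFactor {H : F⟦X⟧[X]} (hH : reduction F H ≠ 0) :
    ∃ (M R : F⟦X⟧[X]) (f : F⟦X⟧), M.Monic ∧ PowerSeries.constantCoeff f ≠ 0 ∧
      H = M * (C f * (1 + tVar F * uVar F * R)) := by
  have hlead : (reduction F H).leadingCoeff ≠ 0 := leadingCoeff_ne_zero.2 hH
  obtain ⟨M, I, rfl, hM, -, hI⟩ := exists_monic_lift_mul PowerSeries.constantCoeff_surj
    (P := H) (monic_mul_leadingCoeff_inv hH)
    ⟨0, C (reduction F H).leadingCoeff⁻¹,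
      by rw [zero_mul, zero_add, ← C_mul, inv_mul_cancel₀ hlead, C_1]⟩
    (by rw [mul_assoc, ← C_mul, inv_mul_cancel₀ hlead, C_1, mul_one, reduction_apply])
  obtain ⟨J, hIJ, hJ, hJ0, -⟩ := exists_eq_C_mul_of_reduction_eq hlead coeff_one_zero
    (by rw [mul_one, ← hI, reduction_apply])
  obtain ⟨R, rfl⟩ := exists_eq_add_tVar_mul_uVar_mul (P := J) (Q := 1) (by rw [hJ, map_one])
    (by rw [hJ0, coeff_one_zero])
  exact ⟨M, R, I.coeff 0, hM, by rwa [← coeff_reduction, reduction_apply, hI, coeff_C_zero],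
    by rw [← hIJ]⟩

theorem degree_one_sub_constant_mul_uVar_pow_le (a : F) (n : ℕ) :
    ((1 - constant a * uVar F) ^ n).degree ≤ n := by
  rw [← natDegree_le_iff_degree_le, constant, uVar]
  compute_degree

theorem exists_eq_C_mul_finiteFactor {M : F⟦X⟧[X]} {a : F} (ha : a ≠ 0) {n : ℕ} (hM : M.Monic)
    (h : reduction F M = (X - C a) ^ n) : ∃ Q : F⟦X⟧[X], Q.degree < n ∧
      M = C (M.coeff 0) * ((1 - constant a⁻¹ * uVar F) ^ n + tVar F * uVar F * Q) := by
  obtain ⟨N, hMN, hN, hN0, hdeg⟩ := exists_eq_C_mul_of_reduction_eq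
    (pow_ne_zero n (neg_ne_zero.2 ha)) (coeff_zero_one_sub_C_inv_mul_X_pow a n)
    (h.trans (X_sub_C_pow_eq ha n))
  obtain ⟨Q, hQ⟩ := exists_eq_add_tVar_mul_uVar_mul (P := N)
    (Q := (1 - constant a⁻¹ * uVar F) ^ n) (by simp [hN])
    (by rw [hN0]; simp [uVar, coeff_zero_eq_eval_zero])
  have hNn : N.degree = n := by
    rw [hdeg, ← hM.degree_map PowerSeries.constantCoeff, ← reduction_apply, h, degree_pow,
      degree_X_sub_C, nsmul_one]
  refine ⟨Q, degree_tVar_mul_uVar_mul_le_iff.1 ?_, by rw [← hQ, ← hMN]⟩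
  rw [← add_sub_cancel_left ((1 - constant a⁻¹ * uVar F) ^ n) (tVar F * uVar F * Q), ← hQ]
  exact (degree_sub_le _ _).trans
    (max_le hNn.le (degree_one_sub_constant_mul_uVar_pow_le _ _))

theorem exists_eq_prod_X_sub_C_pow [IsAlgClosed F] {g : F[X]} (hg : g.Monic) :
    ∃ (k : ℕ) (α : Fin k → F) (e : Fin k → ℕ), Function.Injective α ∧ (∀ i, 0 < e i) ∧
      g = ∏ i, (X - C (α i)) ^ e i := by
  classical
  let s := g.roots.toFinset
  refine ⟨s.card, fun i => s.equivFin.symm i, fun i => g.roots.count ↑(s.equivFin.symm i),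
    Subtype.val_injective.comp s.equivFin.symm.injective,
    fun i => Multiset.count_pos.2 (Multiset.mem_toFinset.1 (s.equivFin.symm i).2), ?_⟩
  rw [Equiv.prod_comp s.equivFin.symm fun a : s => (X - C (a : F)) ^ g.roots.count ↑a,
    Finset.prod_coe_sort s fun a => (X - C a) ^ g.roots.count a, ← Finset.prod_multiset_map_count]
  exact (IsAlgClosed.splits g).eq_prod_roots_of_monic hg

theorem exists_eq_C_mul_prod_finiteFactor [IsAlgClosed F] {M : F⟦X⟧[X]} (hM : M.Monic)
    (h0 : (reduction F M).coeff 0 ≠ 0) :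
    ∃ (k : ℕ) (α : Fin k → F) (e : Fin k → ℕ) (Q : Fin k → F⟦X⟧[X]),
      (∀ i, α i ≠ 0) ∧ Function.Injective α ∧ (∀ i, 0 < e i) ∧ (∀ i, (Q i).degree < e i) ∧
      M = C (M.coeff 0) *
        ∏ i, ((1 - constant (α i)⁻¹ * uVar F) ^ e i + tVar F * uVar F * Q i) := by
  obtain ⟨k, α, e, hinj, he, hMα⟩ :=
    exists_eq_prod_X_sub_C_pow (hM.map (PowerSeries.constantCoeff (R := F)))
  have hα (i) : α i ≠ 0 := fun hi => h0 <| by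
    rw [reduction_apply, hMα, coeff_zero_eq_eval_zero, eval_prod]
    exact Finset.prod_eq_zero (Finset.mem_univ i) (by simp [hi, (he i).ne'])
  obtain ⟨G, rfl, hG⟩ := exists_monic_lift_prod PowerSeries.constantCoeff_surj Finset.univ
    (fun i _ => (monic_X_sub_C (α i)).pow (e i)) (fun i _ j _ hij =>
      (isCoprime_X_sub_C_of_isUnit_sub (sub_ne_zero.2 (hinj.ne hij)).isUnit).pow) hM hMα
  choose Q hQ hGQ using fun i => exists_eq_C_mul_finiteFactor (hα i) (hG i (Finset.mem_univ i)).1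
    (hG i (Finset.mem_univ i)).2
  refine ⟨k, α, e, Q, hα, hinj, he, hQ, ?_⟩
  have hG0 : (∏ i, G i).coeff 0 = ∏ i, (G i).coeff 0 := by
    simp only [coeff_zero_eq_eval_zero, eval_prod]
  rw [hG0, map_prod, ← Finset.prod_mul_distrib]
  exact Finset.prod_congr rfl fun i _ => hGQ i

theorem exists_isFactorizationOf (K L : Type*) [Field K] [Field L] [Algebra K L] [IsAlgClosed L]
    {Δ : K⟦X⟧[X]} (hΔ : Δ ≠ 0) : ∃ D : FactorizationData K L, D.IsFactorizationOf Δ := by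
  obtain ⟨p, P, rfl, hP⟩ := exists_eq_tVar_pow_mul hΔ
  obtain ⟨d, R₂, H, hR₂, rfl, hH⟩ := exists_eq_zeroFactor_mul hP
  obtain ⟨M, R₁, f, hM, hf, rfl⟩ := exists_eq_monic_mul_infiniteFactor
    (show reduction K H ≠ 0 from fun h => hH (by rw [h, coeff_zero]))
  rw [map_mul, mul_coeff_zero] at hH
  have hM0 : (reduction K M).coeff 0 ≠ 0 := left_ne_zero_of_mul hH
  obtain ⟨k, α, e, Q, hα, hinj, he, hQ, hMα⟩ := exists_eq_C_mul_prod_finiteFactor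
    (M := extendScalars L M) (hM.map _) (by simpa [reduction_extendScalars] using hM0)
  obtain ⟨S, hS⟩ := exists_eq_C_mul_one_add_X_mul (f := M.coeff 0 * f)
    (by rw [map_mul, ← coeff_reduction]; exact mul_ne_zero hM0 hf)
  set c := PowerSeries.constantCoeff (M.coeff 0 * f)
  refine ⟨⟨c, p, S, R₁, d, R₂, k, α, e, Q⟩, hR₂, hα, hinj, he, hQ, ?_⟩
  rw [FactorizationData.unitPart_eq, FactorizationData.unitSeries, ← hS]
  simp only [map_mul, extendScalars_C, FactorizationData.infiniteFactor,
    FactorizationData.zeroFactor, FactorizationData.finiteFactor]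
  rw [hMα, coeff_zero_extendScalars]
  ring

end Existence

section LocalFactors

open Polynomial

namespace FactorizationData

variable {K L : Type*} [Field K] [Field L]

/-- The values at `t = 0` of the finite roots: `0` at `none`, and `αᵢ` at `some i`. -/
def center (D : FactorizationData K L) : Option (Fin D.k) → L
  | none => 0
  | some i => D.α i

/-- The multiplicity of a center as a root modulo `t`: `d` at `none`, and `dᵢ` at `some i`. -/
def mult (D : FactorizationData K L) : Option (Fin D.k) → ℕ
  | none => D.d
  | some i => D.e i

/-- The product of the factors of `Δ` that are constant modulo `t`: the unit `c (1 + t S)` and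
`1 + t u R₁`. -/
noncomputable def unitFactor (D : FactorizationData K L) : K⟦X⟧[X] :=
  C D.unitSeries * D.infiniteFactor

theorem coeff_zero_infiniteFactor (D : FactorizationData K L) : D.infiniteFactor.coeff 0 = 1 := by
  simp [infiniteFactor, tVar, uVar, mul_coeff_zero]

theorem coeff_zero_finiteFactor (D : FactorizationData K L) (i : Fin D.k) :
    (D.finiteFactor i).coeff 0 = 1 := by
  simp [finiteFactor, tVar, uVar, coeff_zero_eq_eval_zero]

theorem reduction_finiteFactor (D : FactorizationData K L) (i : Fin D.k) :
    reduction L (D.finiteFactor i) = (1 - C (D.α i)⁻¹ * X) ^ D.e i := by simp [finiteFactor]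

theorem reduction_zeroFactor (D : FactorizationData K L) :
    reduction K D.zeroFactor = X ^ D.d := by simp [zeroFactor]

theorem reduction_infiniteFactor (D : FactorizationData K L) :
    reduction K D.infiniteFactor = 1 := by simp [infiniteFactor]

theorem reduction_unitFactor (D : FactorizationData K L) :
    reduction K D.unitFactor = C D.c := by
  rw [unitFactor, map_mul, reduction_C, constantCoeff_unitSeries, reduction_infiniteFactor,
    mul_one]

theorem coeff_zero_unitFactor (D : FactorizationData K L) :
    D.unitFactor.coeff 0 = D.unitSeries := by
  rw [unitFactor, coeff_C_mul, coeff_zero_infiniteFactor, mul_one]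

variable [Algebra K L]

/-- The factors of `Δ` whose roots are finite at `t = 0`: `u^d + t R₂` at `none`, and
`(1 - u/αᵢ)^{dᵢ} + t u Qᵢ` at `some i`. -/
noncomputable def localFactor (D : FactorizationData K L) : Option (Fin D.k) → L⟦X⟧[X]
  | none => extendScalars L D.zeroFactor
  | some i => D.finiteFactor i

/-- The factorization without the power of `t`. -/
noncomputable def tFreePart (D : FactorizationData K L) : L⟦X⟧[X] :=
  extendScalars L D.unitFactor * ∏ o, D.localFactor o

theorem reduction_extendScalars_unitFactor (D : FactorizationData K L) :
    reduction L (extendScalars L D.unitFactor) = C (algebraMap K L D.c) := by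
  rw [reduction_extendScalars, reduction_unitFactor, map_C]

theorem extendScalars_eq_tVar_pow_mul {D : FactorizationData K L} {Δ : K⟦X⟧[X]}
    (h : D.IsFactorizationOf Δ) : extendScalars L Δ = tVar L ^ D.p * D.tFreePart := by
  have ht : extendScalars L (tVar K) = tVar L := by
    rw [tVar, extendScalars_C, PowerSeries.map_X, tVar]
  rw [h.eq, unitPart_eq, map_mul, map_pow, ht, tFreePart, unitFactor, map_mul, Fintype.prod_option]
  simp only [localFactor]
  ring

namespace IsFactorizationOf

variable {D : FactorizationData K L} {Δ : K⟦X⟧[X]} (h : D.IsFactorizationOf Δ)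
include h

theorem c_ne_zero (hΔ : Δ ≠ 0) : D.c ≠ 0 := by
  refine fun hc => hΔ (extendScalars_injective (F := L) ?_)
  simp [extendScalars_eq_tVar_pow_mul h, tFreePart, unitFactor, unitSeries, hc]

theorem center_injective : Function.Injective D.center
  | none, none, _ => rfl
  | none, some i, hi => (h.α_ne_zero i hi.symm).elim
  | some i, none, hi => (h.α_ne_zero i hi).elim
  | some _, some _, hij => congrArg some (h.α_injective hij)

theorem monic_zeroFactor : D.zeroFactor.Monic :=
  monic_X_pow_add ((degree_tVar_mul _).trans_lt h.degree_R₂)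

theorem natDegree_localFactor_le : ∀ o, (D.localFactor o).natDegree ≤ D.mult o
  | none => natDegree_map_le.trans <| natDegree_le_of_degree_le
      ((degree_add_le _ _).trans (max_le (degree_X_pow_le _)
        ((degree_tVar_mul _).trans_lt h.degree_R₂).le))
  | some i => natDegree_le_of_degree_le <| (degree_add_le _ _).trans <|
      max_le (degree_one_sub_constant_mul_uVar_pow_le _ _)
        (degree_tVar_mul_uVar_mul_le_iff.2 (h.degree_Q i))

theorem associated_reduction_localFactor : ∀ o,
    Associated (reduction L (D.localFactor o)) ((X - C (D.center o)) ^ D.mult o)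
  | none => by
    simp [localFactor, center, mult, reduction_extendScalars, reduction_zeroFactor]
  | some i => by
    simpa only [localFactor, center, mult, reduction_finiteFactor] using
      associated_one_sub_C_inv_mul_X_pow (h.α_ne_zero i) (D.e i)

theorem reduction_localFactor_ne_zero (o : Option (Fin D.k)) :
    reduction L (D.localFactor o) ≠ 0 :=
  (h.associated_reduction_localFactor o).ne_zero_iff.2 (pow_ne_zero _ (X_sub_C_ne_zero _))

theorem natDegree_reduction_localFactor (o : Option (Fin D.k)) :
    (reduction L (D.localFactor o)).natDegree = D.mult o := by
  rw [natDegree_eq_of_degree_eq (degree_eq_degree_of_associated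
    (h.associated_reduction_localFactor o)), natDegree_pow, natDegree_X_sub_C, mul_one]

theorem isUnit_leadingCoeff_localFactor (o : Option (Fin D.k)) :
    IsUnit (D.localFactor o).leadingCoeff :=
  isUnit_leadingCoeff_of_natDegree_le (h.reduction_localFactor_ne_zero o)
    ((h.natDegree_localFactor_le o).trans_eq (h.natDegree_reduction_localFactor o).symm)

theorem natDegree_localFactor (o : Option (Fin D.k)) : (D.localFactor o).natDegree = D.mult o :=
  (h.natDegree_localFactor_le o).antisymm <|
    (h.natDegree_reduction_localFactor o).symm.trans_le natDegree_map_le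

theorem isUnit_reduction_unitFactor (hΔ : Δ ≠ 0) :
    IsUnit (reduction L (extendScalars L D.unitFactor)) := by
  rw [reduction_extendScalars_unitFactor]
  exact isUnit_C.2 ((_root_.map_ne_zero _).2 (h.c_ne_zero hΔ)).isUnit

theorem reduction_tFreePart_ne_zero (hΔ : Δ ≠ 0) : reduction L D.tFreePart ≠ 0 := by
  rw [tFreePart, map_mul, map_prod]
  exact mul_ne_zero (h.isUnit_reduction_unitFactor hΔ).ne_zero
    (Finset.prod_ne_zero_iff.2 fun o _ => h.reduction_localFactor_ne_zero o)

theorem roots_reduction_tFreePart (hΔ : Δ ≠ 0) :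
    (reduction L D.tFreePart).roots = ∑ o, D.mult o • {D.center o} := by
  have hc := (_root_.map_ne_zero (algebraMap K L)).2 (h.c_ne_zero hΔ)
  have hprod := Finset.prod_ne_zero_iff.2 fun o (_ : o ∈ Finset.univ) =>
    h.reduction_localFactor_ne_zero o
  rw [tFreePart, map_mul, map_prod, reduction_extendScalars_unitFactor, roots_C_mul _ hc,
    roots_prod _ _ hprod]
  refine Finset.sum_congr rfl fun o _ => ?_
  rw [(h.associated_reduction_localFactor o).roots_eq, roots_pow, roots_X_sub_C]

theorem count_center_roots_reduction [DecidableEq L] (hΔ : Δ ≠ 0) (o : Option (Fin D.k)) :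
    (reduction L D.tFreePart).roots.count (D.center o) = D.mult o := by
  simp only [h.roots_reduction_tFreePart hΔ, Multiset.count_sum', Multiset.count_nsmul,
    Multiset.count_singleton, h.center_injective.eq_iff, mul_ite, mul_one, mul_zero,
    Finset.sum_ite_eq, Finset.mem_univ, if_true]

theorem range_α_eq (hΔ : Δ ≠ 0) :
    Set.range D.α = {a | a ≠ 0 ∧ a ∈ (reduction L D.tFreePart).roots} := by
  ext a
  simp only [h.roots_reduction_tFreePart hΔ, Set.mem_range, Set.mem_ofPred_eq, Multiset.mem_sum,
    Finset.mem_univ, true_and]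
  constructor
  · rintro ⟨i, rfl⟩
    exact ⟨h.α_ne_zero i, some i, by simp [center, mult, Multiset.mem_nsmul, (h.e_pos i).ne']⟩
  · rintro ⟨ha, o | i, ho⟩ <;> have ho := Multiset.mem_singleton.1 (Multiset.mem_of_mem_nsmul ho)
    · exact (ha ho).elim
    · exact ⟨i, ho.symm⟩

theorem isCoprime_reduction_localFactor {o o' : Option (Fin D.k)} (ho : o ≠ o') :
    IsCoprime (reduction L (D.localFactor o)) (reduction L (D.localFactor o')) := by
  have hunit := (sub_ne_zero.2 (h.center_injective.ne ho)).isUnit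
  exact ((isCoprime_X_sub_C_of_isUnit_sub hunit).pow.of_isCoprime_of_dvd_left
    (h.associated_reduction_localFactor o).dvd).of_isCoprime_of_dvd_right
    (h.associated_reduction_localFactor o').dvd

theorem isCoprime_reduction_cofactor (hΔ : Δ ≠ 0) (o : Option (Fin D.k)) :
    IsCoprime (reduction L (D.localFactor o))
      (reduction L (extendScalars L D.unitFactor *
        ∏ o' ∈ Finset.univ.erase o, D.localFactor o')) := by
  rw [map_mul, map_prod, isCoprime_mul_unit_left_right (h.isUnit_reduction_unitFactor hΔ)]
  exact IsCoprime.prod_right fun o' ho' =>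
    h.isCoprime_reduction_localFactor (Finset.ne_of_mem_erase ho').symm

end IsFactorizationOf

end FactorizationData

end LocalFactors

section Uniqueness

open Polynomial

namespace FactorizationData.IsFactorizationOf

variable {K L : Type*} [Field K] [Field L] [Algebra K L] {D D' : FactorizationData K L}
  {Δ : K⟦X⟧[X]} (h : D.IsFactorizationOf Δ) (h' : D'.IsFactorizationOf Δ) (hΔ : Δ ≠ 0)
include h h' hΔ

theorem p_eq : D.p = D'.p := by
  rw [← multiplicity_tVar_pow_mul D.p (h.reduction_tFreePart_ne_zero hΔ),
    ← multiplicity_tVar_pow_mul D'.p (h'.reduction_tFreePart_ne_zero hΔ),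
    ← extendScalars_eq_tVar_pow_mul h, ← extendScalars_eq_tVar_pow_mul h']

theorem tFreePart_eq : D.tFreePart = D'.tFreePart := by
  have heq := (extendScalars_eq_tVar_pow_mul h).symm.trans (extendScalars_eq_tVar_pow_mul h')
  rw [p_eq h h' hΔ] at heq
  exact mul_left_cancel₀ (pow_ne_zero _ tVar_ne_zero) heq

theorem mult_eq {o : Option (Fin D.k)} {o' : Option (Fin D'.k)} (ho : D.center o = D'.center o') :
    D.mult o = D'.mult o' := by
  classical
  rw [← h.count_center_roots_reduction hΔ, ← h'.count_center_roots_reduction hΔ,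
    tFreePart_eq h h' hΔ, ho]

theorem exists_equiv_α_eq : ∃ σ : Fin D.k ≃ Fin D'.k, ∀ i, D.α i = D'.α (σ i) := by
  have hrange : Set.range D.α = Set.range D'.α := by
    rw [h.range_α_eq hΔ, h'.range_α_eq hΔ, tFreePart_eq h h' hΔ]
  refine ⟨(Equiv.ofInjective D.α h.α_injective).trans
    ((Equiv.setCongr hrange).trans (Equiv.ofInjective D'.α h'.α_injective).symm), fun i => ?_⟩
  simp only [Equiv.trans_apply, Equiv.apply_ofInjective_symm, Equiv.setCongr_apply,
    Equiv.ofInjective_apply]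

theorem exists_localFactor_eq_mul_C {o : Option (Fin D.k)} {o' : Option (Fin D'.k)}
    (ho : D.center o = D'.center o') : ∃ a, D.localFactor o = D'.localFactor o' * C a := by
  have hm := mult_eq h h' hΔ ho
  have hassoc : Associated (reduction L (D.localFactor o)) (reduction L (D'.localFactor o')) := by
    refine (h.associated_reduction_localFactor o).trans ?_
    rw [ho, hm]
    exact (h'.associated_reduction_localFactor o').symm
  refine exists_eq_mul_C_of_mul_eq_mul (φ := PowerSeries.constantCoeff)
    (g := extendScalars L D.unitFactor * ∏ i ∈ Finset.univ.erase o, D.localFactor i)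
    (G := extendScalars L D'.unitFactor * ∏ i ∈ Finset.univ.erase o', D'.localFactor i)
    (h'.isUnit_leadingCoeff_localFactor o') ?_ ?_ ?_
  · rw [natDegree_localFactor h', ← hm]
    exact h.natDegree_localFactor_le o
  · exact (h.isCoprime_reduction_cofactor hΔ o).of_isCoprime_of_dvd_left hassoc.symm.dvd
  · rw [mul_left_comm, mul_left_comm (D'.localFactor o'), Finset.mul_prod_erase _ _ (by simp),
      Finset.mul_prod_erase _ _ (by simp)]
    exact tFreePart_eq h h' hΔ

theorem zeroFactor_eq : D.zeroFactor = D'.zeroFactor := by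
  obtain ⟨a, ha⟩ := exists_localFactor_eq_mul_C h h' hΔ (o := none) (o' := none) rfl
  simp only [localFactor] at ha
  have hmonic := h.monic_zeroFactor.map (PowerSeries.map (algebraMap K L))
  have hmonic' := h'.monic_zeroFactor.map (PowerSeries.map (algebraMap K L))
  obtain rfl : a = 1 := by
    simpa [extendScalars, hmonic.leadingCoeff, hmonic'.leadingCoeff, eq_comm] using
      congrArg leadingCoeff ha
  exact extendScalars_injective (F := L) (by rw [ha, C_1, mul_one])

theorem finiteFactor_eq {i : Fin D.k} {j : Fin D'.k} (hij : D.α i = D'.α j) :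
    D.finiteFactor i = D'.finiteFactor j := by
  obtain ⟨a, ha⟩ := exists_localFactor_eq_mul_C h h' hΔ (o := some i) (o' := some j) hij
  simp only [localFactor] at ha
  obtain rfl : a = 1 := by
    simpa [coeff_zero_finiteFactor, eq_comm] using congrArg (coeff · 0) ha
  rw [ha, C_1, mul_one]

theorem unitFactor_eq : D.unitFactor = D'.unitFactor := by
  obtain ⟨σ, hσ⟩ := exists_equiv_α_eq h h' hΔ
  have hprod : ∏ o, D.localFactor o = ∏ o, D'.localFactor o := by
    simp only [Fintype.prod_option, localFactor, zeroFactor_eq h h' hΔ]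
    rw [Fintype.prod_equiv σ _ _ fun i => finiteFactor_eq h h' hΔ (hσ i)]
  refine extendScalars_injective (F := L)
    (mul_right_cancel₀ (b := ∏ o, D.localFactor o) ?_ ?_)
  · exact Finset.prod_ne_zero_iff.2 fun o _ ho =>
      h.reduction_localFactor_ne_zero o (by rw [ho, map_zero])
  · have := tFreePart_eq h h' hΔ
    rwa [tFreePart, tFreePart, ← hprod] at this

theorem unitSeries_eq : D.unitSeries = D'.unitSeries := by
  rw [← coeff_zero_unitFactor, unitFactor_eq h h' hΔ, coeff_zero_unitFactor]

theorem infiniteFactor_eq : D.infiniteFactor = D'.infiniteFactor := by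
  have hC : C D'.unitSeries ≠ 0 := C_ne_zero.2 fun h0 =>
    h'.c_ne_zero hΔ (by rw [← constantCoeff_unitSeries, h0, map_zero])
  have hU := unitFactor_eq h h' hΔ
  rw [unitFactor, unitFactor, unitSeries_eq h h' hΔ] at hU
  exact mul_left_cancel₀ hC hU

theorem c_eq : D.c = D'.c := by
  rw [← constantCoeff_unitSeries, ← constantCoeff_unitSeries, unitSeries_eq h h' hΔ]

theorem S_eq : D.S = D'.S := by
  have hS := unitSeries_eq h h' hΔ
  rw [unitSeries, unitSeries, c_eq h h' hΔ] at hS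
  have hc : PowerSeries.C D'.c ≠ 0 := (_root_.map_ne_zero _).2 (h'.c_ne_zero hΔ)
  exact mul_left_cancel₀ PowerSeries.X_ne_zero (add_left_cancel (mul_left_cancel₀ hc hS))

theorem R₁_eq : D.R₁ = D'.R₁ :=
  mul_left_cancel₀ (mul_ne_zero tVar_ne_zero X_ne_zero)
    (add_left_cancel (infiniteFactor_eq h h' hΔ))

theorem R₂_eq : D.R₂ = D'.R₂ := by
  have hR := zeroFactor_eq h h' hΔ
  rw [zeroFactor, zeroFactor, show D.d = D'.d from
    mult_eq h h' hΔ (o := none) (o' := none) rfl] at hR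
  exact mul_left_cancel₀ tVar_ne_zero (add_left_cancel hR)

theorem Q_eq {i : Fin D.k} {j : Fin D'.k} (hij : D.α i = D'.α j) : D.Q i = D'.Q j := by
  have hQ := finiteFactor_eq h h' hΔ hij
  rw [finiteFactor, finiteFactor, hij, show D.e i = D'.e j from
    mult_eq h h' hΔ (o := some i) (o' := some j) hij] at hQ
  exact mul_left_cancel₀ (mul_ne_zero tVar_ne_zero X_ne_zero) (add_left_cancel hQ)

theorem equivalent : D.Equivalent D' := by
  obtain ⟨σ, hσ⟩ := exists_equiv_α_eq h h' hΔ
  exact ⟨c_eq h h' hΔ, p_eq h h' hΔ, S_eq h h' hΔ, R₁_eq h h' hΔ,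
    mult_eq h h' hΔ (o := none) (o' := none) rfl, R₂_eq h h' hΔ, σ, fun i =>
      ⟨hσ i, mult_eq h h' hΔ (o := some i) (o' := some (σ i)) (hσ i), Q_eq h h' hΔ (hσ i)⟩⟩

end FactorizationData.IsFactorizationOf

end Uniqueness

section ValueAtZero

open Polynomial

section OrderTop

variable {Γ R : Type*} [AddCommMonoid Γ] [LinearOrder Γ] [IsOrderedCancelAddMonoid Γ]
  [NonUnitalNonAssocSemiring R]

theorem coeff_zero_mul_of_orderTop_nonneg {x y : R⟦Γ⟧} (hx : 0 ≤ x.orderTop)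
    (hy : 0 ≤ y.orderTop) : (x * y).coeff 0 = x.coeff 0 * y.coeff 0 := by
  obtain hx0 | hx0 := hx.lt_or_eq
  · rw [HahnSeries.coeff_eq_zero_of_lt_orderTop hx0, zero_mul]
    exact HahnSeries.coeff_eq_zero_of_lt_orderTop
      ((hx0.trans_le (le_add_of_nonneg_right hy)).trans_le HahnSeries.orderTop_add_le_mul)
  obtain hy0 | hy0 := hy.lt_or_eq
  · rw [HahnSeries.coeff_eq_zero_of_lt_orderTop hy0, mul_zero]
    exact HahnSeries.coeff_eq_zero_of_lt_orderTop
      ((hy0.trans_le (le_add_of_nonneg_left hx)).trans_le HahnSeries.orderTop_add_le_mul)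
  have order_eq_zero {z : R⟦Γ⟧} (hz : 0 = z.orderTop) : z.order = 0 := by
    have hz0 : z ≠ 0 := fun h => by simp [h] at hz
    exact WithTop.coe_injective ((HahnSeries.order_eq_orderTop_of_ne_zero hz0).trans hz.symm)
  simpa only [order_eq_zero hx0, order_eq_zero hy0, add_zero, HahnSeries.leadingCoeff_eq] using
    HahnSeries.coeff_mul_order_add_order x y

end OrderTop

namespace PuiseuxSeries

variable {L : Type*} [Field L]

/-- The `t`-adic valuation on the field of Puiseux series; its ring of integers consists of the
series that are finite at `t = 0`. -/
noncomputable def valuation (L : Type*) [Field L] :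
    Valuation (PuiseuxSeries L) (Multiplicative (WithTop ℚ)ᵒᵈ) :=
  (AddValuation.toValuation (HahnSeries.addVal ℚ L)).comap (PuiseuxSeries L).subtype

theorem isFiniteAtZero_iff_orderTop_nonneg {U : PuiseuxSeries L} :
    IsFiniteAtZero U ↔ 0 ≤ (U : L⟦ℚ⟧).orderTop := by
  simp [IsFiniteAtZero, HahnSeries.le_orderTop_iff_forall]

theorem mem_integer_iff {U : PuiseuxSeries L} :
    U ∈ (valuation L).integer ↔ IsFiniteAtZero U :=
  isFiniteAtZero_iff_orderTop_nonneg.symm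

theorem isInfiniteAtZero_iff {U : PuiseuxSeries L} :
    IsInfiniteAtZero U ↔ ¬ IsFiniteAtZero U := by
  simp [IsFiniteAtZero, IsInfiniteAtZero]

/-- Evaluation at `t = 0` of the Puiseux series that are finite there. -/
noncomputable def valueAtZero (L : Type*) [Field L] : (valuation L).integer →+* L where
  toFun U := (U : L⟦ℚ⟧).coeff 0
  map_one' := by simp
  map_zero' := by simp
  map_add' U V := by simp
  map_mul' U V := coeff_zero_mul_of_orderTop_nonneg
    (isFiniteAtZero_iff_orderTop_nonneg.1 (mem_integer_iff.1 U.2))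
    (isFiniteAtZero_iff_orderTop_nonneg.1 (mem_integer_iff.1 V.2))

theorem isFiniteAtZero_powerSeriesToPuiseux (f : L⟦X⟧) :
    IsFiniteAtZero (powerSeriesToPuiseux L f) := by
  intro q hq
  by_contra h
  obtain ⟨n, -, rfl⟩ := HahnSeries.support_embDomain_subset
    (x := HahnSeries.toPowerSeries.symm f) (a := q) h
  exact hq.not_ge (Nat.cast_nonneg n)

/-- The inclusion of `L[[t]]` into the ring of Puiseux series that are finite at `t = 0`. -/
noncomputable def powerSeriesToInteger (L : Type*) [Field L] : L⟦X⟧ →+* (valuation L).integer :=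
  (powerSeriesToPuiseux L).codRestrict _ fun f =>
    mem_integer_iff.2 (isFiniteAtZero_powerSeriesToPuiseux f)

theorem subtype_comp_powerSeriesToInteger :
    (valuation L).integer.subtype.comp (powerSeriesToInteger L) = powerSeriesToPuiseux L := rfl

theorem valueAtZero_comp_powerSeriesToInteger :
    (valueAtZero L).comp (powerSeriesToInteger L) = PowerSeries.constantCoeff := by
  ext f
  have hf := HahnSeries.ofPowerSeries_apply_coeff (Γ := ℚ) f 0
  rwa [Nat.cast_zero, PowerSeries.coeff_zero_eq_constantCoeff_apply] at hf

theorem powerSeriesToPuiseux_injective : Function.Injective (powerSeriesToPuiseux L) :=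
  fun _ _ h => HahnSeries.ofPowerSeries_injective (congrArg Subtype.val h)

theorem isRoot_reduction {P : L⟦X⟧[X]} {U : PuiseuxSeries L} (hU : IsFiniteAtZero U)
    (h : (P.map (powerSeriesToPuiseux L)).IsRoot U) :
    (reduction L P).IsRoot ((U : L⟦ℚ⟧).coeff 0) := by
  lift U to (valuation L).integer using mem_integer_iff.2 hU
  have hroot : P.eval₂ (powerSeriesToInteger L) U = 0 := by
    refine Subtype.val_injective ?_
    rwa [IsRoot, eval_map, ← subtype_comp_powerSeriesToInteger, ← Subring.subtype_apply,
      ← hom_eval₂] at h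
  rw [IsRoot, reduction_apply, eval_map, ← valueAtZero_comp_powerSeriesToInteger]
  exact (hom_eval₂ P _ (valueAtZero L) U).symm.trans (by rw [hroot, map_zero])

theorem isFiniteAtZero_of_isRoot {P : L⟦X⟧[X]} (hP : IsUnit P.leadingCoeff)
    {U : PuiseuxSeries L} (h : (P.map (powerSeriesToPuiseux L)).IsRoot U) : IsFiniteAtZero U := by
  rw [IsRoot, eval_map] at h
  have hint : powerSeriesToPuiseux L P.leadingCoeff * U ∈ (valuation L).integer :=
    (Valuation.integer.integers (valuation L)).mem_of_integral
      (RingHom.IsIntegralElem.of_comp (f := powerSeriesToInteger L)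
        (RingHom.isIntegralElem_leadingCoeff_mul _ P U h))
  obtain ⟨b, hb⟩ := hP.exists_left_inv
  rw [← mem_integer_iff, ← one_mul U, ← map_one (powerSeriesToPuiseux L), ← hb, map_mul, mul_assoc]
  exact mul_mem (powerSeriesToInteger L b).2 hint

end PuiseuxSeries

end ValueAtZero

section PuiseuxRoots

open Polynomial PuiseuxSeries

variable {L : Type*} [Field L]

theorem map_powerSeriesToPuiseux_ne_zero {P : L⟦X⟧[X]} (hP : P ≠ 0) :
    P.map (powerSeriesToPuiseux L) ≠ 0 :=
  (Polynomial.map_ne_zero_iff powerSeriesToPuiseux_injective).2 hP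

theorem puiseuxRoots_C_mul {f : L⟦X⟧} (hf : f ≠ 0) (P : L⟦X⟧[X]) :
    puiseuxRoots (C f * P) = puiseuxRoots P := by
  rw [puiseuxRoots, Polynomial.map_mul, map_C,
    roots_C_mul _ ((map_ne_zero_iff _ powerSeriesToPuiseux_injective).2 hf), puiseuxRoots]

theorem puiseuxRootsWith_mul_eq_puiseuxRoots_left {p : PuiseuxSeries L → Prop} {A B : L⟦X⟧[X]}
    (h : A * B ≠ 0) (hA : ∀ U, (A.map (powerSeriesToPuiseux L)).IsRoot U → p U)
    (hB : ∀ U, (B.map (powerSeriesToPuiseux L)).IsRoot U → ¬ p U) :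
    puiseuxRootsWith p (A * B) = puiseuxRoots A := by
  classical
  have hmap := map_powerSeriesToPuiseux_ne_zero h
  rw [Polynomial.map_mul] at hmap
  rw [puiseuxRootsWith, puiseuxRoots, Polynomial.map_mul, roots_mul hmap, Multiset.filter_add,
    Multiset.filter_eq_self.2 fun U hU => hA U (isRoot_of_mem_roots hU),
    Multiset.filter_eq_nil.2 fun U hU => hB U (isRoot_of_mem_roots hU), puiseuxRoots]
  exact add_zero _

namespace FactorizationData

variable {K : Type*} [Field K] [Algebra K L] {D : FactorizationData K L} {Δ : K⟦X⟧[X]}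

theorem isInfiniteAtZero_of_isRoot {U : PuiseuxSeries L}
    (hU : ((extendScalars L D.infiniteFactor).map (powerSeriesToPuiseux L)).IsRoot U) :
    IsInfiniteAtZero U := by
  refine isInfiniteAtZero_iff.2 fun hfin => ?_
  have hroot := isRoot_reduction hfin hU
  rw [reduction_extendScalars, reduction_infiniteFactor, Polynomial.map_one] at hroot
  exact one_ne_zero (eval_one.symm.trans hroot)

namespace IsFactorizationOf

variable (h : D.IsFactorizationOf Δ)
include h

theorem isEqualAtZero_center_of_isRoot {o : Option (Fin D.k)} {U : PuiseuxSeries L}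
    (hU : ((D.localFactor o).map (powerSeriesToPuiseux L)).IsRoot U) :
    IsEqualAtZero (D.center o) U := by
  have hfin := isFiniteAtZero_of_isRoot (h.isUnit_leadingCoeff_localFactor o) hU
  have hroot := (isRoot_reduction hfin hU).dvd (h.associated_reduction_localFactor o).dvd
  rw [IsRoot, eval_pow, eval_sub, eval_X, eval_C] at hroot
  exact ⟨hfin, sub_eq_zero.1 (eq_zero_of_pow_eq_zero hroot)⟩

theorem exists_center_of_isRoot_prod {s : Finset (Option (Fin D.k))} {U : PuiseuxSeries L}
    (hU : ((∏ o ∈ s, D.localFactor o).map (powerSeriesToPuiseux L)).IsRoot U) :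
    ∃ o ∈ s, IsEqualAtZero (D.center o) U := by
  rw [Polynomial.map_prod, isRoot_prod] at hU
  obtain ⟨o, ho, hU⟩ := hU
  exact ⟨o, ho, h.isEqualAtZero_center_of_isRoot hU⟩

theorem puiseuxRootsWith_eq (hΔ : Δ ≠ 0) (p : PuiseuxSeries L → Prop) :
    puiseuxRootsWith p (extendScalars L Δ) =
      puiseuxRootsWith p (extendScalars L D.infiniteFactor * ∏ o, D.localFactor o) := by
  have heq : extendScalars L Δ = C (PowerSeries.X ^ D.p * PowerSeries.map (algebraMap K L)
      D.unitSeries) * (extendScalars L D.infiniteFactor * ∏ o, D.localFactor o) := by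
    rw [extendScalars_eq_tVar_pow_mul h, tFreePart, unitFactor, map_mul, extendScalars_C, tVar,
      C_mul, C_pow]
    ring
  have hne : C (PowerSeries.X ^ D.p * PowerSeries.map (algebraMap K L) D.unitSeries) ≠ 0 :=
    left_ne_zero_of_mul (heq ▸ (map_ne_zero_iff _ extendScalars_injective).2 hΔ)
  rw [puiseuxRootsWith, heq, puiseuxRoots_C_mul (C_ne_zero.1 hne), puiseuxRootsWith]

theorem infiniteFactor_mul_prod_localFactor_ne_zero :
    extendScalars L D.infiniteFactor * ∏ o, D.localFactor o ≠ 0 := by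
  refine fun h0 => mul_ne_zero one_ne_zero
    (Finset.prod_ne_zero_iff.2 fun o (_ : o ∈ Finset.univ) => h.reduction_localFactor_ne_zero o) ?_
  rw [← map_prod, ← Polynomial.map_one (algebraMap K L), ← D.reduction_infiniteFactor,
    ← reduction_extendScalars, ← map_mul, h0, map_zero]

theorem puiseuxRootsWith_isInfiniteAtZero (hΔ : Δ ≠ 0) :
    puiseuxRootsWith IsInfiniteAtZero (extendScalars L Δ) =
      puiseuxRoots (extendScalars L D.infiniteFactor) := by
  rw [h.puiseuxRootsWith_eq hΔ]
  refine puiseuxRootsWith_mul_eq_puiseuxRoots_left h.infiniteFactor_mul_prod_localFactor_ne_zero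
    (fun _ => isInfiniteAtZero_of_isRoot) fun U hU => ?_
  obtain ⟨o, -, hfin, -⟩ := h.exists_center_of_isRoot_prod hU
  exact fun hinf => isInfiniteAtZero_iff.1 hinf hfin

theorem puiseuxRootsWith_isEqualAtZero_center (hΔ : Δ ≠ 0) (o : Option (Fin D.k)) :
    puiseuxRootsWith (IsEqualAtZero (D.center o)) (extendScalars L Δ) =
      puiseuxRoots (D.localFactor o) := by
  have hne := h.infiniteFactor_mul_prod_localFactor_ne_zero
  rw [h.puiseuxRootsWith_eq hΔ]
  rw [← Finset.mul_prod_erase _ _ (Finset.mem_univ o), mul_left_comm] at hne ⊢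
  refine puiseuxRootsWith_mul_eq_puiseuxRoots_left hne
    (fun _ => h.isEqualAtZero_center_of_isRoot) fun U hU hUo => ?_
  rw [Polynomial.map_mul, root_mul] at hU
  obtain hU | hU := hU
  · exact isInfiniteAtZero_iff.1 (isInfiniteAtZero_of_isRoot hU) hUo.1
  · obtain ⟨o', ho', hUo'⟩ := h.exists_center_of_isRoot_prod hU
    exact Finset.ne_of_mem_erase ho' (h.center_injective (hUo'.2.symm.trans hUo.2))

theorem puiseuxRootsWith_isFiniteNonzeroAtZero (hΔ : Δ ≠ 0) :
    puiseuxRootsWith IsFiniteNonzeroAtZero (extendScalars L Δ) =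
      puiseuxRoots (∏ i, D.finiteFactor i) := by
  have hne := h.infiniteFactor_mul_prod_localFactor_ne_zero
  rw [h.puiseuxRootsWith_eq hΔ]
  rw [Fintype.prod_option, ← mul_assoc, mul_comm] at hne ⊢
  refine puiseuxRootsWith_mul_eq_puiseuxRoots_left hne (fun U hU => ?_) fun U hU hUf => ?_
  · rw [Polynomial.map_prod, isRoot_prod] at hU
    obtain ⟨i, -, hU⟩ := hU
    have hUi := h.isEqualAtZero_center_of_isRoot (o := some i) hU
    exact ⟨hUi.1, hUi.2.trans_ne (h.α_ne_zero i)⟩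
  · rw [Polynomial.map_mul, root_mul] at hU
    obtain hU | hU := hU
    · exact isInfiniteAtZero_iff.1 (isInfiniteAtZero_of_isRoot hU) hUf.1
    · exact hUf.2 (h.isEqualAtZero_center_of_isRoot hU).2

end IsFactorizationOf

end FactorizationData

end PuiseuxRoots

theorem mainTheorem4_general (K : Type*) [Field K]
    (L : Type*) [Field L] [Algebra K L] [IsAlgClosed L]
    (Δ : K⟦X⟧[X]) (hΔ : Δ ≠ 0) :
    (∃ D : FactorizationData K L, D.IsFactorizationOf Δ) ∧
    (∀ D D' : FactorizationData K L,
      D.IsFactorizationOf Δ → D'.IsFactorizationOf Δ → D.Equivalent D') ∧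
    (∀ D : FactorizationData K L, D.IsFactorizationOf Δ →
      puiseuxRootsWith PuiseuxSeries.IsInfiniteAtZero (extendScalars L Δ) =
        puiseuxRoots (extendScalars L D.infiniteFactor) ∧
      puiseuxRootsWith (PuiseuxSeries.IsEqualAtZero 0) (extendScalars L Δ) =
        puiseuxRoots (extendScalars L D.zeroFactor) ∧
      puiseuxRootsWith PuiseuxSeries.IsFiniteNonzeroAtZero (extendScalars L Δ) =
        puiseuxRoots (∏ i, D.finiteFactor i) ∧
      ∀ i, puiseuxRootsWith (PuiseuxSeries.IsEqualAtZero (D.α i)) (extendScalars L Δ) =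
        puiseuxRoots (D.finiteFactor i)) :=
  ⟨exists_isFactorizationOf K L hΔ, fun _ _ h h' => h.equivalent h' hΔ, fun _ h =>
    ⟨h.puiseuxRootsWith_isInfiniteAtZero hΔ, h.puiseuxRootsWith_isEqualAtZero_center hΔ none,
      h.puiseuxRootsWith_isFiniteNonzeroAtZero hΔ,
      fun i => h.puiseuxRootsWith_isEqualAtZero_center hΔ (some i)⟩⟩

theorem mainTheorem4 (K : Type*) [Field K] [CharZero K]
    (L : Type*) [Field L] [Algebra K L] [IsAlgClosure K L]
    (Δ : K⟦X⟧[X]) (hΔ : Δ ≠ 0) :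
    (∃ D : FactorizationData K L, D.IsFactorizationOf Δ) ∧
    (∀ D D' : FactorizationData K L,
      D.IsFactorizationOf Δ → D'.IsFactorizationOf Δ → D.Equivalent D') ∧
    (∀ D : FactorizationData K L, D.IsFactorizationOf Δ →
      puiseuxRootsWith PuiseuxSeries.IsInfiniteAtZero (extendScalars L Δ) =
        puiseuxRoots (extendScalars L D.infiniteFactor) ∧
      puiseuxRootsWith (PuiseuxSeries.IsEqualAtZero 0) (extendScalars L Δ) =
        puiseuxRoots (extendScalars L D.zeroFactor) ∧
      puiseuxRootsWith PuiseuxSeries.IsFiniteNonzeroAtZero (extendScalars L Δ) =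
        puiseuxRoots (∏ i, D.finiteFactor i) ∧
      ∀ i, puiseuxRootsWith (PuiseuxSeries.IsEqualAtZero (D.α i)) (extendScalars L Δ) =
        puiseuxRoots (D.finiteFactor i)) := by
  have : IsAlgClosed L := IsAlgClosure.isAlgClosed K
  exact mainTheorem4_general K L Δ hΔ
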